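/- **Theorem 4.1.** Let $\Omega\subset\mathbb C$ be a non-empty, bounded, open and connected set such that for all $z\in\mathbb C$ and $r>0$: if $D(z,r)\setminus\{z\}\subset\Omega$, then $z\in\Omega$, where $D(z,r)$ is the open disc of centre $z$ and radius $r$. Let $X$ be a linear subspace of the space $\mathrm{Hol}(\Omega)$ of holomorphic functions on $\Omega$, endowed with a norm that makes it a complex Banach space and for which every point evaluation $f\mapsto f(z)$, $z\in\Omega$, is bounded on $X$ (that is, $X\hookrightarrow \mathrm{Hol}(\Omega)$). Suppose that - $\Omega$ is maximal for $X$: for every $w\in\partial\Omega$ and every $\varepsilon>0$ there is $f\in X$ that has no holomorphic extension to $\Omega\cup D(w,\varepsilon)$; - the identity function $e_1(z)=z$ belongs to $X$; - the density condition (D) holds: for every $w\in\partial\Omega$ there is $\varepsilon>0$ such that the set of those $f\in X$ that have a holomorphic extension to $\Omega\cup D(w,\varepsilon)$ is dense in $X$. Let $G\in\mathrm{Hol}(\Omega)$, and for $z\in\Omega$ let $\varphi(\cdot,z):[0,\tau(z))\to\Omega$, $0<\tau(z)\le\infty$, be the unique maximal solution of $u'(t)=G(u(t))$, $u(0)=z$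 (the semiflow generated by $G$). Let $T=(T(t))_{t\ge 0}$ be a $C_0$-semigroup of bounded operators on $X$ whose generator $A$, with domain $D(A)$, satisfies $Af=Gf'$ for all $f\in D(A)$. Then the semiflow is global, i.e. $\tau(z)=\infty$ for all $z\in\Omega$; $$(T(t)f)(z)=f(\varphi(t,z))\qquad\text{for all } f\in X,\ z\in\Omega,\ t\ge 0;$$ and $$D(A)=\{f\in X: Gf'\in X\}.$$ -/

import Mathlib

open Set Filter Topology Metric

noncomputable section

namespace HolSemi

/-! ### Banach spaces of holomorphic functions -/

/-- Realizes the normed space `X` as a space of holomorphic functions on `Ω` with bounded point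
evaluations, `X ↪ Hol(Ω)`.  An element of `Hol(Ω)` is represented by a function `ℂ → ℂ` that is
holomorphic on `Ω`; its values outside `Ω` carry no information (two elements of `X` with the same
values on `Ω` are equal). -/
structure Embedding (Ω : Set ℂ) (X : Type*) [NormedAddCommGroup X] [NormedSpace ℂ X] where
  /-- the inclusion of `X` into the functions -/
  toFun : X →ₗ[ℂ] (ℂ → ℂ)
  holomorphic : ∀ f : X, DifferentiableOn ℂ (toFun f) Ω
  injective : ∀ f g : X, EqOn (toFun f) (toFun g) Ω → f = g
  eval_bounded : ∀ z ∈ Ω, ∃ c : ℝ, ∀ f : X, ‖toFun f z‖ ≤ c * ‖f‖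

variable {Ω : Set ℂ} {X : Type*} [NormedAddCommGroup X] [NormedSpace ℂ X]

/-- The function `h` on `Ω` belongs to `X`. -/
def Embedding.Contains (ι : Embedding Ω X) (h : ℂ → ℂ) : Prop :=
  ∃ g : X, EqOn (ι.toFun g) h Ω

/-- `f ∈ X` has a holomorphic extension to `Ω ∪ D(w, ε)`. -/
def Embedding.HasExtension (ι : Embedding Ω X) (f : X) (w : ℂ) (ε : ℝ) : Prop :=
  ∃ F : ℂ → ℂ, DifferentiableOn ℂ F (Ω ∪ ball w ε) ∧ EqOn F (ι.toFun f) Ω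

/-- The domain `Ω` is maximal for `X`. -/
def Embedding.MaximalDomain (ι : Embedding Ω X) : Prop :=
  ∀ w ∈ frontier Ω, ∀ ε : ℝ, 0 < ε → ∃ f : X, ¬ ι.HasExtension f w ε

/-- The density condition (D). -/
def Embedding.DensityCondition (ι : Embedding Ω X) : Prop :=
  ∀ w ∈ frontier Ω, ∃ ε : ℝ, 0 < ε ∧ Dense {f : X | ι.HasExtension f w ε}

/-- The weak boundary regularity condition: `Ω` has no punctures. -/
def WeakBoundaryRegular (Ω : Set ℂ) : Prop :=
  ∀ (z : ℂ) (r : ℝ), 0 < r → ball z r \ {z} ⊆ Ω → z ∈ Ω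

/-! ### Strongly continuous semigroups and their generators -/

/-- `(T t)_{t ≥ 0}` is a `C₀`-semigroup of bounded operators (the values of `T` at negative `t` are
irrelevant). -/
structure IsC0Semigroup (T : ℝ → X →L[ℂ] X) : Prop where
  zero : T 0 = ContinuousLinearMap.id ℂ X
  add : ∀ s t : ℝ, 0 ≤ s → 0 ≤ t → T (s + t) = (T s).comp (T t)
  tendsto : ∀ f : X, Tendsto (fun t : ℝ => T t f) (𝓝[>] 0) (𝓝 f)

/-- `(T t f - f) / t → g` as `t ↓ 0`. -/
def HasGeneratorValue (T : ℝ → X →L[ℂ] X) (f g : X) : Prop :=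
  Tendsto (fun t : ℝ => (t : ℂ)⁻¹ • (T t f - f)) (𝓝[>] 0) (𝓝 g)

theorem HasGeneratorValue.unique {T : ℝ → X →L[ℂ] X} {f g h : X}
    (hg : HasGeneratorValue T f g) (hh : HasGeneratorValue T f h) : g = h :=
  tendsto_nhds_unique hg hh

theorem HasGeneratorValue.add {T : ℝ → X →L[ℂ] X} {f₁ f₂ g₁ g₂ : X}
    (h₁ : HasGeneratorValue T f₁ g₁) (h₂ : HasGeneratorValue T f₂ g₂) :
    HasGeneratorValue T (f₁ + f₂) (g₁ + g₂) := by
  refine (Tendsto.add h₁ h₂).congr fun t => ?_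
  rw [← smul_add, map_add]
  congr 1
  abel

theorem HasGeneratorValue.smul {T : ℝ → X →L[ℂ] X} {f g : X} (c : ℂ)
    (h : HasGeneratorValue T f g) : HasGeneratorValue T (c • f) (c • g) := by
  refine (Tendsto.const_smul h c).congr fun t => ?_
  rw [map_smul, ← smul_sub, smul_comm]

/-- The infinitesimal generator of `T`, an operator with domain
`{f | lim_{t ↓ 0} (T t f - f) / t exists}`. -/
def generator (T : ℝ → X →L[ℂ] X) : X →ₗ.[ℂ] X where
  domain :=
    { carrier := {f | ∃ g, HasGeneratorValue T f g}
      add_mem' := fun ⟨_, h₁⟩ ⟨_, h₂⟩ => ⟨_, h₁.add h₂⟩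
      zero_mem' := ⟨0, by simp [HasGeneratorValue]⟩
      smul_mem' := fun c _ ⟨_, h⟩ => ⟨_, h.smul c⟩ }
  toFun :=
    { toFun := fun f => f.2.choose
      map_add' := fun f g =>
        (f + g).2.choose_spec.unique (f.2.choose_spec.add g.2.choose_spec)
      map_smul' := fun c f => (c • f).2.choose_spec.unique (f.2.choose_spec.smul c) }

theorem hasGeneratorValue_generator (T : ℝ → X →L[ℂ] X) (f : (generator T).domain) :
    HasGeneratorValue T f (generator T f) :=
  f.2.choose_spec

/-! ### The semiflow generated by a holomorphic function -/

/-- `u` solves `u' = G(u)`, `u(0) = z` in `Ω` on the interval `[0, b)`, `b ∈ [-∞, ∞]`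
(with a one-sided derivative at `0`). -/
structure IsSolution (Ω : Set ℂ) (G : ℂ → ℂ) (z : ℂ) (b : EReal) (u : ℝ → ℂ) : Prop where
  initial : u 0 = z
  mem : ∀ t : ℝ, 0 ≤ t → (t : EReal) < b → u t ∈ Ω
  deriv : ∀ t : ℝ, 0 ≤ t → (t : EReal) < b → HasDerivWithinAt u (G (u t)) (Ici 0) t

/-- The life time `τ(z)` of the maximal solution starting at `z`. -/
def lifetime (Ω : Set ℂ) (G : ℂ → ℂ) (z : ℂ) : EReal :=
  sSup {b : EReal | ∃ u : ℝ → ℂ, IsSolution Ω G z b u}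

open Classical in
/-- The semiflow `φ(t, z)` generated by `G`: the value at time `t` of any solution starting at `z`
whose interval of existence contains `t` (solutions are unique when `G` is holomorphic on the open
set `Ω`), and the junk value `0` if there is none, that is, if `t ≥ τ(z)`. -/
def semiflow (Ω : Set ℂ) (G : ℂ → ℂ) (t : ℝ) (z : ℂ) : ℂ :=
  if h : ∃ u : ℝ → ℂ, ∃ b : EReal, (t : EReal) < b ∧ IsSolution Ω G z b u then h.choose t else 0

/-- The semiflow generated by `G` is global: `τ(z) = ∞` for all `z ∈ Ω`. -/
def IsGlobalSemiflow (Ω : Set ℂ) (G : ℂ → ℂ) : Prop :=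
  ∀ z ∈ Ω, lifetime Ω G z = ⊤

end HolSemi

end

/-! ### C₀-semigroups: local boundedness, orbits and the generator. -/

noncomputable section

namespace HolSemi

variable {X : Type*} [NormedAddCommGroup X] [NormedSpace ℂ X]

namespace IsC0Semigroup

variable {T : ℝ → X →L[ℂ] X}

/-! Let `u` solve `u' = G(u)`, `u 0 = z`. Since the generator acts as `f ↦ G f'`, the product rule
shows that `r ↦ (T r f)(u (t - r))` is constant for `f` in the domain; density of the domain then
gives `(T t f) z = f (u t)` for all `f` (`eval_eq_of_isSolution`). With `e` the identity function,
`u t = v t := (T t e) z`, and `v` is continuous for all times, so a solution on `[0, b)` has a limit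
`w = v b`.

If `w ∈ Ω`, local existence continues the solution past `b`. If `w ∈ ∂Ω`, put `a = b / 2` and `ψ = T
a e`. Then `ψ (v a) = w` and `ψ` is open near `v a`. Whenever `g` has an extension `F` across `w`,
the identity theorem gives `T a g = F ∘ ψ` near `v a`; hence `F` near `w` is controlled by `T a g`
on a compact subset of `Ω`, that is, by the norm of `g`. Extendability thus passes to limits, and
the density condition makes every function of `X` extend across `w`, contradicting maximality
(`hasExtension_of_dense`, `eval_orbit_mem`). So the flow is global.

For the domain, if `g = G f'` lies in `X`, integrating `f` along the flow yields `T t f = f + ∫₀ᵗ T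
s g ds`, whose derivative at `0` is `g`. -/

theorem zero_apply (hT : IsC0Semigroup T) (f : X) : T 0 f = f := by
  rw [hT.zero]; rfl

theorem add_apply (hT : IsC0Semigroup T) {s t : ℝ} (hs : 0 ≤ s) (ht : 0 ≤ t) (f : X) :
    T (s + t) f = T s (T t f) := by
  rw [hT.add s t hs ht]; rfl

theorem tendsto_nhdsGE (hT : IsC0Semigroup T) (f : X) :
    Tendsto (fun t : ℝ => T t f) (𝓝[≥] 0) (𝓝 f) := by
  rw [← Ioi_insert, nhdsWithin_insert]
  refine Tendsto.sup ?_ (hT.tendsto f)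
  rw [tendsto_pure_left]
  intro s hs
  rw [hT.zero_apply]
  exact mem_of_mem_nhds hs

/-- The integral `∫₀ᵗ T(s) f ds`; the orbit is continued constantly to negative times. -/
def orbitIntegral (T : ℝ → X →L[ℂ] X) (f : X) (t : ℝ) : X :=
  ∫ s in (0 : ℝ)..t, T (max s 0) f

theorem orbitIntegral_zero (f : X) : orbitIntegral T f 0 = 0 :=
  intervalIntegral.integral_same

theorem hasGeneratorValue_iff_slope {f g : X} : HasGeneratorValue T f g ↔
    Tendsto (fun t : ℝ => t⁻¹ • (T t f - f)) (𝓝[>] 0) (𝓝 g) := by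
  refine tendsto_congr fun t => ?_
  rw [← Complex.ofReal_inv]
  exact Complex.coe_smul _ _

theorem hasGeneratorValue_iff_hasDerivWithinAt (hT : IsC0Semigroup T) {f g : X} :
    HasGeneratorValue T f g ↔ HasDerivWithinAt (fun t => T t f) g (Ici 0) 0 := by
  rw [hasGeneratorValue_iff_slope, ← hasDerivWithinAt_Ioi_iff_Ici,
    hasDerivWithinAt_iff_tendsto_slope' (by simp)]
  refine tendsto_congr fun t => ?_
  rw [slope_def_module, hT.zero_apply, sub_zero]

variable [CompleteSpace X]

/-- Otherwise some `t n → 0` has `‖T (t n)‖ > n`, while every orbit converges along `t n`; this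
contradicts uniform boundedness. -/
theorem exists_bound_near_zero (hT : IsC0Semigroup T) :
    ∃ δ > 0, ∃ M : ℝ, ∀ t ∈ Icc 0 δ, ‖T t‖ ≤ M := by
  by_contra! h
  have h' : ∀ n : ℕ, ∃ t ∈ Icc (0 : ℝ) (1 / (n + 1)), (n : ℝ) < ‖T t‖ := fun n =>
    h _ (by positivity) n
  choose t ht hn using h'
  have ht0 : Tendsto t atTop (𝓝[≥] 0) := by
    refine tendsto_nhdsWithin_iff.2 ⟨?_, Eventually.of_forall fun n => (ht n).1⟩
    exact squeeze_zero (fun n => (ht n).1) (fun n => (ht n).2)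
      tendsto_one_div_add_atTop_nhds_zero_nat
  obtain ⟨C, hC⟩ := banach_steinhaus (g := fun n => T (t n)) fun f => by
    obtain ⟨C, hC⟩ := ((hT.tendsto_nhdsGE f).comp ht0).norm.bddAbove_range
    exact ⟨C, fun n => hC ⟨n, rfl⟩⟩
  obtain ⟨n, hCn⟩ := exists_nat_ge C
  exact absurd (hC n) (not_le.2 (hCn.trans_lt (hn n)))

theorem exists_bound (hT : IsC0Semigroup T) (R : ℝ) :
    ∃ M : ℝ, ∀ t ∈ Icc 0 R, ‖T t‖ ≤ M := by
  obtain ⟨δ, hδ, M, hM⟩ := hT.exists_bound_near_zero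
  have key : ∀ n : ℕ, ∃ M : ℝ, ∀ t ∈ Icc 0 (n * δ), ‖T t‖ ≤ M := by
    intro n
    induction n with
    | zero =>
      refine ⟨M, fun t ht => hM t ⟨ht.1, ht.2.trans ?_⟩⟩
      simpa using hδ.le
    | succ n ih =>
      obtain ⟨M', hM'⟩ := ih
      refine ⟨max M' (M * M'), fun t ht => ?_⟩
      rcases le_total t (n * δ) with h | h
      · exact (hM' t ⟨ht.1, h⟩).trans (le_max_left _ _)
      · have hnδ : 0 ≤ n * δ := by positivity
        have h1 : t - n * δ ∈ Icc 0 δ := by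
          have := ht.2
          push_cast at this
          exact ⟨by linarith, by linarith⟩
        have h2 : T t = (T (t - n * δ)).comp (T (n * δ)) := by
          rw [← hT.add _ _ h1.1 hnδ]; congr 1; ring
        rw [h2]
        refine ((ContinuousLinearMap.opNorm_comp_le _ _).trans ?_).trans (le_max_right _ _)
        exact mul_le_mul (hM _ h1) (hM' _ ⟨hnδ, le_rfl⟩) (norm_nonneg _)
          ((norm_nonneg _).trans (hM _ h1))
  obtain ⟨n, hn⟩ := exists_nat_ge (R / δ)
  obtain ⟨M', hM'⟩ := key n
  exact ⟨M', fun t ht => hM' t ⟨ht.1, ht.2.trans ((div_le_iff₀ hδ).1 hn)⟩⟩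

theorem continuousOn_orbit (hT : IsC0Semigroup T) (f : X) :
    ContinuousOn (fun t => T t f) (Ici 0) := by
  intro t ht
  obtain ⟨M, hM⟩ := hT.exists_bound (t + 1)
  have hle : ∀ s r : ℝ, 0 ≤ s → s ≤ r → r ≤ t + 1 →
      ‖T r f - T s f‖ ≤ M * ‖T |r - s| f - f‖ := by
    intro s r hs hsr hr
    have h1 : T r f = T s (T (r - s) f) := by
      rw [← hT.add_apply hs (sub_nonneg.2 hsr)]; congr 2; ring
    rw [abs_of_nonneg (sub_nonneg.2 hsr), h1, ← map_sub]
    exact (T s).le_of_opNorm_le (hM s ⟨hs, hsr.trans hr⟩) _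
  have hev : ∀ᶠ s in 𝓝[Ici 0] t, ‖T s f - T t f‖ ≤ M * ‖T |s - t| f - f‖ := by
    have : ∀ᶠ s in 𝓝[Ici 0] t, s ≤ t + 1 :=
      nhdsWithin_le_nhds (eventually_le_nhds (by linarith))
    filter_upwards [this, self_mem_nhdsWithin] with s hs hs0
    rcases le_total s t with h | h
    · rw [norm_sub_rev, abs_sub_comm]
      exact hle s t hs0 h (by linarith)
    · exact hle t s ht h hs
  rw [ContinuousWithinAt, tendsto_iff_norm_sub_tendsto_zero]
  refine squeeze_zero' (Eventually.of_forall fun _ => norm_nonneg _) hev ?_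
  have habs : Tendsto (fun s : ℝ => |s - t|) (𝓝[Ici 0] t) (𝓝[≥] 0) := by
    refine tendsto_nhdsWithin_iff.2 ⟨?_, Eventually.of_forall fun s => mem_Ici.2 (abs_nonneg _)⟩
    have : Continuous fun s : ℝ => |s - t| := by fun_prop
    simpa using (this.tendsto t).mono_left nhdsWithin_le_nhds
  have := (((hT.tendsto_nhdsGE f).comp habs).sub_const f).norm.const_mul M
  simpa using this

theorem continuous_orbit_max (hT : IsC0Semigroup T) (f : X) :
    Continuous fun t : ℝ => T (max t 0) f :=
  (hT.continuousOn_orbit f).comp_continuous (by fun_prop) fun _ => mem_Ici.2 (le_max_right _ _)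

/-- The constant continuation makes the integrand continuous on `ℝ`, so the derivative is two-sided
even at `t = 0`. -/
theorem hasDerivAt_orbitIntegral (hT : IsC0Semigroup T) (f : X) {t : ℝ} (ht : 0 ≤ t) :
    HasDerivAt (orbitIntegral T f) (T t f) t := by
  have h := hT.continuous_orbit_max f
  have := intervalIntegral.integral_hasDerivAt_right (h.intervalIntegrable 0 t)
    h.stronglyMeasurable.stronglyMeasurableAtFilter h.continuousAt
  rwa [max_eq_left ht] at this

theorem apply_orbitIntegral (hT : IsC0Semigroup T) (f : X) {h t : ℝ} (hh : 0 ≤ h) (ht : 0 ≤ t) :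
    T h (orbitIntegral T f t) = orbitIntegral T f (t + h) - orbitIntegral T f h := by
  have hc := hT.continuous_orbit_max f
  rw [orbitIntegral, ← (T h).intervalIntegral_comp_comm (hc.intervalIntegrable _ _)]
  have h1 : ∫ s in (0 : ℝ)..t, T h (T (max s 0) f) = ∫ s in (0 : ℝ)..t, T (max (s + h) 0) f := by
    refine intervalIntegral.integral_congr fun s hs => ?_
    rw [uIcc_of_le ht] at hs
    rw [← hT.add_apply hh (le_max_right _ _), max_eq_left hs.1, max_eq_left (by linarith [hs.1]),
      add_comm]
  rw [h1, intervalIntegral.integral_comp_add_right (fun s => T (max s 0) f) h, zero_add]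
  exact (intervalIntegral.integral_interval_sub_left (hc.intervalIntegrable _ _)
    (hc.intervalIntegrable _ _)).symm

theorem hasGeneratorValue_orbitIntegral (hT : IsC0Semigroup T) (f : X) {t : ℝ} (ht : 0 ≤ t) :
    HasGeneratorValue T (orbitIntegral T f t) (T t f - f) := by
  rw [hT.hasGeneratorValue_iff_hasDerivWithinAt]
  have h1 : HasDerivAt (fun h => orbitIntegral T f (t + h)) (T t f) 0 :=
    HasDerivAt.comp_const_add t 0 (by simpa using hT.hasDerivAt_orbitIntegral f ht)
  have h2 : HasDerivAt (orbitIntegral T f) f 0 := by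
    simpa [hT.zero_apply] using hT.hasDerivAt_orbitIntegral f le_rfl
  refine (h1.sub h2).hasDerivWithinAt.congr (fun h hh => ?_) ?_
  · exact hT.apply_orbitIntegral f hh ht
  · exact hT.apply_orbitIntegral f le_rfl ht

/-- The averages `t⁻¹ ∫₀ᵗ T s f ds` lie in the domain and tend to `f`. -/
theorem dense_domain (hT : IsC0Semigroup T) : Dense ((generator T).domain : Set X) := by
  intro f
  have h2 : HasDerivAt (orbitIntegral T f) f 0 := by
    simpa [hT.zero_apply] using hT.hasDerivAt_orbitIntegral f le_rfl
  have h3 : Tendsto (slope (orbitIntegral T f) 0) (𝓝[>] 0) (𝓝 f) :=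
    (hasDerivWithinAt_iff_tendsto_slope' (by simp)).1 (h2.hasDerivWithinAt (s := Ioi 0))
  refine mem_closure_of_tendsto h3 ?_
  filter_upwards [self_mem_nhdsWithin] with t ht
  rw [slope_def_module, orbitIntegral_zero, sub_zero, sub_zero, ← Complex.coe_smul]
  exact Submodule.smul_mem _ _ ⟨_, hT.hasGeneratorValue_orbitIntegral f (le_of_lt ht)⟩

end IsC0Semigroup

theorem _root_.Filter.Tendsto.comp_const_add_nhdsGT {α : Type*} {l : Filter α} {F : ℝ → α} {r : ℝ}
    (h : Tendsto (fun t => F (r + t)) (𝓝[>] 0) l) : Tendsto F (𝓝[>] r) l := by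
  have : Tendsto (fun t : ℝ => t - r) (𝓝[>] r) (𝓝[>] 0) := by
    refine tendsto_nhdsWithin_iff.2 ⟨?_, ?_⟩
    · have : Continuous fun t : ℝ => t - r := by fun_prop
      simpa using (this.tendsto r).mono_left nhdsWithin_le_nhds
    · filter_upwards [self_mem_nhdsWithin] with t ht
      exact mem_Ioi.2 (sub_pos.2 (mem_Ioi.1 ht))
  simpa [Function.comp_def] using h.comp this

namespace IsC0Semigroup
variable {T : ℝ → X →L[ℂ] X}

theorem hasGeneratorValue_apply (hT : IsC0Semigroup T) {f g : X} (h : HasGeneratorValue T f g)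
    {r : ℝ} (hr : 0 ≤ r) : HasGeneratorValue T (T r f) (T r g) := by
  refine (((T r).continuous.tendsto g).comp h).congr' ?_
  filter_upwards [self_mem_nhdsWithin] with t ht
  have ht : 0 ≤ t := le_of_lt ht
  simp only [Function.comp_apply, map_smul, map_sub]
  rw [← hT.add_apply hr ht, ← hT.add_apply ht hr, add_comm]

theorem hasDerivWithinAt_orbit (hT : IsC0Semigroup T) {f g : X} (h : HasGeneratorValue T f g)
    {r : ℝ} (hr : 0 ≤ r) : HasDerivWithinAt (fun t => T t f) (T r g) (Ici r) r := by
  rw [← hasDerivWithinAt_Ioi_iff_Ici, hasDerivWithinAt_iff_tendsto_slope' (by simp)]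
  refine Tendsto.comp_const_add_nhdsGT ?_
  refine (hasGeneratorValue_iff_slope.1 (hT.hasGeneratorValue_apply h hr)).congr' ?_
  filter_upwards [self_mem_nhdsWithin] with t ht
  rw [slope_def_module, ← hT.add_apply (le_of_lt ht) hr]
  simp [add_comm]

end IsC0Semigroup
end HolSemi
end

/-! ### Evaluation at moving points, and the semigroup along solutions. -/

noncomputable section

namespace HolSemi

variable {Ω : Set ℂ} {X : Type*} [NormedAddCommGroup X] [NormedSpace ℂ X]

namespace Embedding

/-- Evaluation at a point of `Ω` as a bounded functional. -/
def evalCLM (ι : Embedding Ω X) {z : ℂ} (hz : z ∈ Ω) : X →L[ℂ] ℂ :=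
  ((LinearMap.proj z).comp ι.toFun).mkContinuous (ι.eval_bounded z hz).choose
    (ι.eval_bounded z hz).choose_spec

@[simp]
theorem evalCLM_apply (ι : Embedding Ω X) {z : ℂ} (hz : z ∈ Ω) (f : X) :
    ι.evalCLM hz f = ι.toFun f z := rfl

theorem map_sub_apply (ι : Embedding Ω X) (f g : X) (z : ℂ) :
    ι.toFun (f - g) z = ι.toFun f z - ι.toFun g z := by
  rw [map_sub]; rfl

theorem continuousAt_toFun (ι : Embedding Ω X) (hΩ : IsOpen Ω) (f : X) {z : ℂ} (hz : z ∈ Ω) :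
    ContinuousAt (ι.toFun f) z :=
  (ι.holomorphic f).continuousOn.continuousAt (hΩ.mem_nhds hz)

theorem hasDerivAt_toFun (ι : Embedding Ω X) (hΩ : IsOpen Ω) (f : X) {z : ℂ} (hz : z ∈ Ω) :
    HasDerivAt (ι.toFun f) (deriv (ι.toFun f) z) z :=
  ((ι.holomorphic f).differentiableAt (hΩ.mem_nhds hz)).hasDerivAt

variable [CompleteSpace X]

/-- Uniform boundedness upgrades pointwise bounds to bounds uniform on compact sets, because each
function is bounded there. -/
theorem exists_eval_bound (ι : Embedding Ω X) {K : Set ℂ} (hK : IsCompact K) (hKΩ : K ⊆ Ω) :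
    ∃ C : ℝ, ∀ z ∈ K, ∀ f : X, ‖ι.toFun f z‖ ≤ C * ‖f‖ := by
  obtain ⟨C, hC⟩ := banach_steinhaus (g := fun z : K => ι.evalCLM (hKΩ z.2)) fun f => by
    obtain ⟨C, hC⟩ := hK.exists_bound_of_continuousOn ((ι.holomorphic f).continuousOn.mono hKΩ)
    exact ⟨C, fun z => hC z z.2⟩
  exact ⟨C, fun z hz f => (ι.evalCLM (hKΩ hz)).le_of_opNorm_le (hC ⟨z, hz⟩) f⟩

theorem tendsto_eval (ι : Embedding Ω X) (hΩ : IsOpen Ω) {α : Type*} {l : Filter α}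
    {F : α → X} {y : α → ℂ} {f : X} {z : ℂ} (hz : z ∈ Ω) (hF : Tendsto F l (𝓝 f))
    (hy : Tendsto y l (𝓝 z)) : Tendsto (fun a => ι.toFun (F a) (y a)) l (𝓝 (ι.toFun f z)) := by
  obtain ⟨K, ⟨hKz, hK⟩, hKΩ⟩ := (compact_basis_nhds z).mem_iff.mp (hΩ.mem_nhds hz)
  obtain ⟨C, hC⟩ := ι.exists_eval_bound hK hKΩ
  have h1 : Tendsto (fun a => ι.toFun f (y a)) l (𝓝 (ι.toFun f z)) :=
    (ι.continuousAt_toFun hΩ f hz).tendsto.comp hy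
  have h2 : Tendsto (fun a => ι.toFun (F a - f) (y a)) l (𝓝 0) := by
    have hF' : Tendsto (fun a => C * ‖F a - f‖) l (𝓝 0) := by
      simpa using (hF.sub_const f).norm.const_mul C
    refine squeeze_zero_norm' ?_ hF'
    filter_upwards [hy hKz] with a ha
    exact hC _ ha _
  simpa [map_sub_apply] using h2.add h1

/-- The difference quotient splits into the slope of `F` evaluated at the moving point `y t`,
handled by `tendsto_eval`, and the slope of the fixed function `F r` along `y`. -/
theorem hasDerivWithinAt_eval (ι : Embedding Ω X) (hΩ : IsOpen Ω) {F : ℝ → X} {y : ℝ → ℂ}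
    {F' : X} {y' : ℂ} {s : Set ℝ} {r : ℝ} (hr : y r ∈ Ω)
    (hF : HasDerivWithinAt F F' s r) (hy : HasDerivWithinAt y y' s r) :
    HasDerivWithinAt (fun t => ι.toFun (F t) (y t))
      (ι.toFun F' (y r) + deriv (ι.toFun (F r)) (y r) * y') s r := by
  have h1 : HasDerivWithinAt (fun t => ι.toFun (F r) (y t))
      (deriv (ι.toFun (F r)) (y r) * y') s r :=
    (ι.hasDerivAt_toFun hΩ (F r) hr).comp_hasDerivWithinAt r hy
  rw [hasDerivWithinAt_iff_tendsto_slope] at h1 hF ⊢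
  have h2 := ι.tendsto_eval hΩ hr hF
    (hy.continuousWithinAt.tendsto.mono_left (nhdsWithin_mono r sdiff_subset))
  refine (h2.add h1).congr fun t => ?_
  rw [slope_def_module, slope_def_module, slope_def_module, ← Complex.coe_smul, map_smul,
    Pi.smul_apply, map_sub_apply, Complex.coe_smul, ← smul_add]
  congr 1
  ring

end Embedding

/-- The generator of `T` is given by `f ↦ G f'`. -/
def GeneratedBy (ι : Embedding Ω X) (T : ℝ → X →L[ℂ] X) (G : ℂ → ℂ) : Prop :=
  ∀ f g : X, HasGeneratorValue T f g → ∀ z ∈ Ω, ι.toFun g z = G z * deriv (ι.toFun f) z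

theorem IsSolution.continuousOn {z : ℂ} {b : EReal} {u : ℝ → ℂ}
    (hu : IsSolution Ω G z b u) {t : ℝ} (htb : (t : EReal) < b) : ContinuousOn u (Icc 0 t) :=
  fun s hs => ((hu.deriv s hs.1 ((EReal.coe_le_coe_iff.2 hs.2).trans_lt htb)).mono
    Icc_subset_Ici_self).continuousWithinAt

namespace IsC0Semigroup

variable [CompleteSpace X] {T : ℝ → X →L[ℂ] X} {G : ℂ → ℂ}

/-- The semigroup is given by composition with the flow along every solution. -/
theorem eval_eq_of_isSolution (hT : IsC0Semigroup T) (ι : Embedding Ω X) (hΩ : IsOpen Ω)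
    (hTG : GeneratedBy ι T G) {z : ℂ} {b : EReal} {u : ℝ → ℂ} (hu : IsSolution Ω G z b u)
    {t : ℝ} (ht : 0 ≤ t) (htb : (t : EReal) < b) (f : X) :
    ι.toFun (T t f) z = ι.toFun f (u t) := by
  have hlt : ∀ s ≤ t, (s : EReal) < b := fun s hs => (EReal.coe_le_coe_iff.2 hs).trans_lt htb
  have hmem : ∀ s ∈ Icc 0 t, u s ∈ Ω := fun s hs => hu.mem s hs.1 (hlt s hs.2)
  have hz : z ∈ Ω := hu.initial ▸ hmem 0 ⟨le_rfl, ht⟩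
  suffices h : ∀ f ∈ ((generator T).domain : Set X), ι.toFun (T t f) z = ι.toFun f (u t) by
    have hclosed : IsClosed {f : X | ι.toFun (T t f) z = ι.toFun f (u t)} :=
      isClosed_eq ((ι.evalCLM hz).comp (T t)).continuous
        (ι.evalCLM (hmem t ⟨ht, le_rfl⟩)).continuous
    exact hclosed.closure_subset_iff.2 h (hT.dense_domain f)
  rintro f ⟨g, hg⟩
  have hmem' : ∀ r ∈ Icc 0 t, t - r ∈ Icc 0 t := fun r hr =>
    ⟨sub_nonneg.2 hr.2, by linarith [hr.1]⟩
  -- This function joins the two sides of the claim, at `r = t` and `r = 0`. The generator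
  -- contributes `G h'` and the backward motion of `u` contributes `-G h'`, where `h = T r f`.
  have hcont : ContinuousOn (fun r => ι.toFun (T r f) (u (t - r))) (Icc 0 t) := by
    intro r hr
    refine ι.tendsto_eval hΩ (hmem _ (hmem' r hr))
      ((hT.continuousOn_orbit f).mono Icc_subset_Ici_self r hr) ?_
    exact (hu.continuousOn htb).comp (by fun_prop) hmem' r hr
  have hderiv : ∀ r ∈ Ico 0 t,
      HasDerivWithinAt (fun r => ι.toFun (T r f) (u (t - r))) 0 (Ici r) r := by
    intro r hr
    have hr' : r ∈ Icc 0 t := ⟨hr.1, hr.2.le⟩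
    have hpos : 0 < t - r := sub_pos.2 hr.2
    have h1 : HasDerivAt u (G (u (t - r))) (t - r) :=
      (hu.deriv _ hpos.le (hlt _ (hmem' r hr').2)).hasDerivAt (Ici_mem_nhds hpos)
    have h2 : HasDerivWithinAt (fun s => u (t - s)) (-G (u (t - r))) (Ici r) r :=
      (h1.comp_const_sub t r).hasDerivWithinAt
    have h3 := ι.hasDerivWithinAt_eval hΩ (y := fun s => u (t - s)) (hmem _ (hmem' r hr'))
      (hT.hasDerivWithinAt_orbit hg hr.1) h2
    refine h3.congr_deriv ?_
    rw [hTG _ _ (hT.hasGeneratorValue_apply hg hr.1) _ (hmem _ (hmem' r hr'))]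
    ring
  have := constant_of_has_deriv_right_zero hcont hderiv t ⟨ht, le_rfl⟩
  simpa [hT.zero_apply, hu.initial] using this

end IsC0Semigroup

/-- Local solutions exist on a time interval that is uniform in the initial value. -/
theorem exists_isSolution_nhds {G : ℂ → ℂ} (hΩ : IsOpen Ω) (hG : DifferentiableOn ℂ G Ω) {w : ℂ}
    (hw : w ∈ Ω) : ∃ δ : ℝ, 0 < δ ∧ ∀ᶠ x in 𝓝 w, ∃ u, IsSolution Ω G x δ u := by
  have hG1 : ContDiffAt ℝ 1 G w :=
    ((hG.contDiffOn hΩ (n := 1)).contDiffAt (hΩ.mem_nhds hw)).restrict_scalars ℝ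
  obtain ⟨ε, hε, a, r, L, K, hr, hpl⟩ := IsPicardLindelof.of_contDiffAt_one hG1
  obtain ⟨ρ, hρ, hρΩ⟩ := nhds_basis_closedBall.mem_iff.1 (hΩ.mem_nhds hw)
  have hra : r ≤ a := by
    have h1 := (hpl 0).mul_max_le
    have h2 : (0 : ℝ) ≤ L * max (0 + ε - 0) (0 - (0 - ε)) :=
      mul_nonneg L.2 (le_max_of_le_left (by linarith))
    exact_mod_cast sub_nonneg.1 (h2.trans h1)
  lift ρ to NNReal using hρ.le
  have hρ' : 0 < ρ := by exact_mod_cast hρ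
  -- Radius `min a ρ` keeps solutions inside `Ω`; half of it is left for varying the initial value.
  have ha' : 0 < min a ρ := lt_min (hr.trans_le hra) hρ'
  obtain ⟨δ, hδ, hpl'⟩ := (hpl 0).exists_shrink_radius hε (min_le_left a ρ)
    (r' := min a ρ / 2) (NNReal.half_lt_self ha'.ne')
  refine ⟨δ, hδ, ?_⟩
  have hr' : (0 : ℝ) < (min a ρ / 2 : NNReal) := by exact_mod_cast half_pos ha'
  filter_upwards [closedBall_mem_nhds w hr'] with x hx
  -- The fixed point is used directly because its values are known to stay in the ball of radius
  -- `min a ρ`.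
  obtain ⟨α, hα⟩ := ODE.FunSpace.exists_isFixedPt_next hpl' hx
  have hfix : ∀ t ∈ Icc (0 - δ) (0 + δ),
      α.compProj t = ODE.picard (fun _ => G) 0 x α.compProj t := by
    intro t ht
    nth_rw 1 [← hα]
    rw [ODE.FunSpace.compProj_of_mem ht, ODE.FunSpace.next_apply]
  have h0 : (0 : ℝ) ∈ Icc (0 - δ) (0 + δ) := by constructor <;> linarith
  have hder : ∀ t ∈ Icc (0 - δ) (0 + δ),
      HasDerivWithinAt α.compProj (G (α.compProj t)) (Icc (0 - δ) (0 + δ)) t := fun t ht =>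
    (ODE.hasDerivWithinAt_picard_Icc h0 hpl'.continuousOn_uncurry
      α.continuous_compProj.continuousOn
      (fun _ _ => α.compProj_mem_closedBall hpl'.mul_max_le) x ht).congr_of_mem hfix ht
  refine ⟨α.compProj, ?_, fun t _ _ => ?_, fun t ht htδ => ?_⟩
  · rw [hfix 0 h0, ODE.picard_apply₀]
  · have := α.compProj_mem_closedBall (t := t) hpl'.mul_max_le
    exact hρΩ (closedBall_subset_closedBall (by exact_mod_cast min_le_right a ρ) this)
  · have htδ : t < δ := by exact_mod_cast htδ
    exact ((hder t ⟨by linarith, by linarith⟩).hasDerivAt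
      (Icc_mem_nhds (by linarith) (by linarith))).hasDerivWithinAt

end HolSemi
end

/-! ### Continuation of solutions in time, and of functions across the boundary. -/

noncomputable section

namespace HolSemi

variable {Ω : Set ℂ} {X : Type*} [NormedAddCommGroup X] [NormedSpace ℂ X] [CompleteSpace X]
  {T : ℝ → X →L[ℂ] X} {G : ℂ → ℂ}

namespace IsC0Semigroup

theorem continuousOn_eval_orbit (hT : IsC0Semigroup T) (ι : Embedding Ω X) (f : X) {z : ℂ}
    (hz : z ∈ Ω) : ContinuousOn (fun t => ι.toFun (T t f) z) (Ici 0) :=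
  (ι.evalCLM hz).continuous.comp_continuousOn (hT.continuousOn_orbit f)

/-- Any solution is the orbit of the identity function under the semigroup. -/
theorem eq_eval_of_isSolution (hT : IsC0Semigroup T) (ι : Embedding Ω X) (hΩ : IsOpen Ω)
    (hTG : GeneratedBy ι T G) {e : X} (he : EqOn (ι.toFun e) (fun z => z) Ω) {z : ℂ} {b : EReal}
    {u : ℝ → ℂ} (hu : IsSolution Ω G z b u) {t : ℝ} (ht : 0 ≤ t) (htb : (t : EReal) < b) :
    u t = ι.toFun (T t e) z := by
  rw [hT.eval_eq_of_isSolution ι hΩ hTG hu ht htb]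
  exact (he (hu.mem t ht htb)).symm

/-- The restart takes place slightly before `b`, with a life time `δ` uniform near the endpoint. The
overlap with the old solution supplies the two-sided derivative at `b`. -/
theorem exists_isSolution_extension (hT : IsC0Semigroup T) (ι : Embedding Ω X) (hΩ : IsOpen Ω)
    (hTG : GeneratedBy ι T G) {e : X} (he : EqOn (ι.toFun e) (fun z => z) Ω)
    (hG : DifferentiableOn ℂ G Ω) {z : ℂ} (hz : z ∈ Ω) {b : ℝ} (hb : 0 < b)
    (hsol : IsSolution Ω G z b (fun t => ι.toFun (T t e) z))
    (hmem : ι.toFun (T b e) z ∈ Ω) :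
    ∃ c > b, IsSolution Ω G z (c : ℝ) (fun t => ι.toFun (T t e) z) := by
  obtain ⟨δ, hδ, hex⟩ := exists_isSolution_nhds hΩ hG hmem
  have hcont : Tendsto (fun t => ι.toFun (T t e) z) (𝓝[<] b) (𝓝 (ι.toFun (T b e) z)) :=
    ((hT.continuousOn_eval_orbit ι e hz).continuousAt (Ici_mem_nhds hb)).tendsto.mono_left
      nhdsWithin_le_nhds
  have hs : ∀ᶠ s in 𝓝[<] b, max 0 (b - δ) < s :=
    nhdsWithin_le_nhds (lt_mem_nhds (max_lt hb (by linarith)))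
  obtain ⟨s, ⟨⟨u, hu⟩, hs⟩, hsb⟩ := ((hcont.eventually hex).and hs).and self_mem_nhdsWithin |>.exists
  have hsb : s < b := hsb
  have hs0 : 0 < s := (le_max_left _ _).trans_lt hs
  have hsδ : b < s + δ := by linarith [(le_max_right 0 (b - δ)).trans_lt hs]
  have heq : ∀ r, 0 ≤ r → r < δ → ι.toFun (T (r + s) e) z = u r := by
    intro r hr hrδ
    rw [add_comm, hT.add_apply hs0.le hr,
      hT.eval_eq_of_isSolution ι hΩ hTG hsol hs0.le (EReal.coe_lt_coe_iff.2 hsb)]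
    exact (hT.eq_eval_of_isSolution ι hΩ hTG he hu hr (EReal.coe_lt_coe_iff.2 hrδ)).symm
  have heq' : ∀ t ∈ Ico s (s + δ), ι.toFun (T t e) z = u (t - s) := by
    intro t ht
    rw [← heq (t - s) (by linarith [ht.1]) (by linarith [ht.2]), sub_add_cancel]
  refine ⟨s + δ, hsδ, hsol.initial, fun t ht htc => ?_, fun t ht htc => ?_⟩
  · have htc := EReal.coe_lt_coe_iff.1 htc
    rcases lt_or_ge t b with h | h
    · exact hsol.mem t ht (EReal.coe_lt_coe_iff.2 h)
    · rw [heq' t ⟨by linarith, htc⟩]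
      exact hu.mem _ (by linarith) (EReal.coe_lt_coe_iff.2 (by linarith))
  · have htc := EReal.coe_lt_coe_iff.1 htc
    rcases lt_or_ge t b with h | h
    · exact hsol.deriv t ht (EReal.coe_lt_coe_iff.2 h)
    · have hts : 0 < t - s := by linarith
      have h1 : HasDerivAt u (G (u (t - s))) (t - s) :=
        (hu.deriv _ hts.le (EReal.coe_lt_coe_iff.2 (by linarith))).hasDerivAt (Ici_mem_nhds hts)
      rw [heq' t ⟨by linarith, htc⟩]
      refine ((h1.comp_sub_const t s).congr_of_eventuallyEq ?_).hasDerivWithinAt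
      filter_upwards [Ioo_mem_nhds (show s < t by linarith) htc] with r hr
      exact heq' r ⟨hr.1.le, hr.2⟩

end IsC0Semigroup

/-- If a dense set of functions of `X` extends to `Ω ∪ ball w ε`, with extensions that are bounded on
the ball by the values of a bounded operator on a compact set, then all functions of `X` extend. -/
theorem Embedding.hasExtension_of_dense (ι : Embedding Ω X) (hΩ : IsOpen Ω) {w : ℂ} {ε : ℝ}
    {E : Set X} (hE : Dense E) (S : X →L[ℂ] X) {K : Set ℂ} (hK : IsCompact K) (hKΩ : K ⊆ Ω)
    {p : ℂ → ℂ} (hp : MapsTo p (ball w ε) K)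
    (hext : ∀ f ∈ E, ∃ F : ℂ → ℂ, DifferentiableOn ℂ F (ball w ε) ∧
      EqOn F (ι.toFun f) (Ω ∩ ball w ε) ∧ ∀ x ∈ ball w ε, F x = ι.toFun (S f) (p x))
    (f : X) : ι.HasExtension f w ε := by
  classical
  obtain ⟨C, hC⟩ := ι.exists_eval_bound hK hKΩ
  obtain ⟨f', hf'E, hf'⟩ := mem_closure_iff_seq_limit.1 (hE f)
  choose F hFd hFΩ hFp using fun n => hext (f' n) (hf'E n)
  have hFlim : DifferentiableOn ℂ (fun x => ι.toFun (S f) (p x)) (ball w ε) := by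
    refine TendstoLocallyUniformlyOn.differentiableOn (F := F) (φ := atTop) ?_
      (Eventually.of_forall hFd) isOpen_ball
    refine TendstoUniformlyOn.tendstoLocallyUniformlyOn ?_
    have hlim : Tendsto (fun n => C * ‖S (f - f' n)‖) atTop (𝓝 0) := by
      have := ((S.continuous.tendsto _).comp (hf'.const_sub f)).norm.const_mul C
      simpa using this
    rw [Metric.tendstoUniformlyOn_iff]
    intro η hη
    filter_upwards [hlim (Iio_mem_nhds hη)] with n hn x hx
    rw [hFp n x hx, dist_eq_norm, ← ι.map_sub_apply, ← map_sub]
    exact (hC _ (hp hx) _).trans_lt hn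
  -- Pointwise limits suffice, so `Ω ∩ ball w ε` need not be connected.
  have hagree : ∀ x ∈ Ω ∩ ball w ε, ι.toFun (S f) (p x) = ι.toFun f x := by
    intro x hx
    have h1 : Tendsto (fun n => ι.toFun (f' n) x) atTop (𝓝 (ι.toFun f x)) :=
      ((ι.evalCLM hx.1).continuous.tendsto _).comp hf'
    have h2 : Tendsto (fun n => ι.toFun (S (f' n)) (p x)) atTop (𝓝 (ι.toFun (S f) (p x))) :=
      (((ι.evalCLM (hKΩ (hp hx.2))).comp S).continuous.tendsto _).comp hf'
    refine tendsto_nhds_unique (h2.congr fun n => ?_) h1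
    rw [← hFp n x hx.2, hFΩ n hx]
  refine ⟨fun x => if x ∈ Ω then ι.toFun f x else ι.toFun (S f) (p x), ?_, fun x hx => if_pos hx⟩
  rintro x (hx | hx)
  · refine (((ι.hasDerivAt_toFun hΩ f hx).differentiableAt).congr_of_eventuallyEq
      ?_).differentiableWithinAt
    filter_upwards [hΩ.mem_nhds hx] with y hy
    exact if_pos hy
  · refine ((hFlim.differentiableAt (isOpen_ball.mem_nhds hx)).congr_of_eventuallyEq
      ?_).differentiableWithinAt
    filter_upwards [isOpen_ball.mem_nhds hx] with y hy
    split_ifs with h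
    · exact (hagree y ⟨h, hy⟩).symm
    · rfl

/-! ### Global existence and the domain of the generator. -/

namespace IsC0Semigroup

/-- A trajectory does not reach the boundary in finite time. -/
theorem eval_orbit_mem (hT : IsC0Semigroup T) (ι : Embedding Ω X) (hΩ : IsOpen Ω)
    (hTG : GeneratedBy ι T G) {e : X}
    (hmax : ι.MaximalDomain) (hdense : ι.DensityCondition) {z : ℂ} (hz : z ∈ Ω) {b : ℝ}
    (hb : 0 < b) (hsol : IsSolution Ω G z b (fun t => ι.toFun (T t e) z)) :
    ι.toFun (T b e) z ∈ Ω := by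
  by_contra hw
  set v : ℝ → ℂ := fun t => ι.toFun (T t e) z with hv
  set w : ℂ := ι.toFun (T b e) z with hw_def
  -- With this choice `v a` is interior, `ψ` sends it to `w`, and `ψ (v s) = v (s + a)` stays in `Ω`
  -- for `s < a`.
  set a : ℝ := b / 2 with ha_def
  have ha : 0 < a := half_pos hb
  have hab : a < b := half_lt_self hb
  have hvc : ∀ t, 0 < t → ContinuousAt v t := fun t ht =>
    (hT.continuousOn_eval_orbit ι e hz).continuousAt (Ici_mem_nhds ht)
  have hvΩ : ∀ t, 0 ≤ t → t < b → v t ∈ Ω := fun t ht htb =>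
    hsol.mem t ht (EReal.coe_lt_coe_iff.2 htb)
  have hflow : ∀ f : X, ∀ t, 0 ≤ t → t < b → ι.toFun (T t f) z = ι.toFun f (v t) :=
    fun f t ht htb => hT.eval_eq_of_isSolution ι hΩ hTG hsol ht (EReal.coe_lt_coe_iff.2 htb) f
  have hwfr : w ∈ frontier Ω := by
    rw [hΩ.frontier_eq]
    refine ⟨mem_closure_of_tendsto
      ((hvc b hb).tendsto.mono_left (nhdsWithin_le_nhds (s := Iio b))) ?_, hw⟩
    filter_upwards [self_mem_nhdsWithin, nhdsWithin_le_nhds (lt_mem_nhds hb)] with t htb ht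
    exact hvΩ t ht.le htb
  obtain ⟨ε, hε, hdense⟩ := hdense w hwfr
  have hz₁ : v a ∈ Ω := hvΩ a ha.le hab
  set ψ : ℂ → ℂ := ι.toFun (T a e) with hψ
  have hψv : ∀ s, 0 ≤ s → s < b → ψ (v s) = v (s + a) := by
    intro s hs hsb
    rw [hψ, ← hflow _ s hs hsb, ← hT.add_apply hs ha.le]
  have hψw : ψ (v a) = w := by
    rw [hψv a ha.le hab, ha_def, add_halves]
  have hψan : AnalyticAt ℂ ψ (v a) := (ι.holomorphic _).analyticAt (hΩ.mem_nhds hz₁)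
  -- The trajectory avoids `v a` just before time `a`, since `ψ (v s) ∈ Ω` but `w ∉ Ω`. The points
  -- `v s` therefore accumulate at `v a`, as the identity theorem requires.
  have hva : Tendsto v (𝓝[<] a) (𝓝[≠] (v a)) := by
    refine tendsto_nhdsWithin_iff.2 ⟨(hvc a ha).tendsto.mono_left nhdsWithin_le_nhds, ?_⟩
    filter_upwards [self_mem_nhdsWithin, nhdsWithin_le_nhds (lt_mem_nhds ha)] with s hsa hs heq
    have hsa : s < a := hsa
    have : ψ (v s) ∈ Ω := by
      rw [hψv s hs.le (hsa.trans hab)]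
      exact hvΩ _ (by linarith) (by linarith)
    rw [mem_singleton_iff.1 heq, hψw] at this
    exact hw this
  have hopen : 𝓝 w ≤ map ψ (𝓝 (v a)) := by
    rw [← hψw]
    refine hψan.eventually_constant_or_nhds_le_map_nhds.resolve_left fun hconst => ?_
    have h1 := hva.eventually (hconst.filter_mono nhdsWithin_le_nhds)
    obtain ⟨s, ⟨h1, hsa⟩, hs⟩ := ((h1.and self_mem_nhdsWithin).and
      (nhdsWithin_le_nhds (lt_mem_nhds ha))).exists
    have hsa : s < a := hsa
    rw [hψw, hψv s (le_of_lt hs) (hsa.trans hab)] at h1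
    exact hw (h1 ▸ hvΩ (s + a) (by linarith) (by linarith))
  have hψnhds : ψ ⁻¹' ball w ε ∈ 𝓝 (v a) :=
    hψan.continuousAt.preimage_mem_nhds (by rw [hψw]; exact ball_mem_nhds w hε)
  obtain ⟨δ, hδ, hδsub⟩ := Metric.mem_nhds_iff.1 (inter_mem (hΩ.mem_nhds hz₁) hψnhds)
  have hK : closedBall (v a) (δ / 2) ⊆ ball (v a) δ := closedBall_subset_ball (half_lt_self hδ)
  have himg : ψ '' closedBall (v a) (δ / 2) ∈ 𝓝 w :=
    hopen (image_mem_map (closedBall_mem_nhds _ (half_pos hδ)))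
  obtain ⟨ε', hε', hsub⟩ := Metric.mem_nhds_iff.1 (inter_mem himg (ball_mem_nhds w hε))
  -- An arbitrary choice of preimages under `ψ`; no continuity of `p` is needed, only that it takes
  -- values in a compact set.
  choose! p hpK hp using fun x (hx : x ∈ ball w ε') => (hsub hx).1
  obtain ⟨f, hf⟩ := hmax w hwfr ε' hε'
  refine hf (ι.hasExtension_of_dense hΩ hdense (T a) (isCompact_closedBall (v a) (δ / 2))
    (fun y hy => (hδsub (hK hy)).1) (p := p) (fun x hx => hpK x hx) ?_ f)
  rintro g ⟨F, hFd, hF⟩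
  refine ⟨F, hFd.mono fun x hx => Or.inr (hsub hx).2, fun x hx => hF hx.1, fun x hx => ?_⟩
  -- At `v s` with `s < a` both sides equal `g (v (s + a))`, by the semigroup law and the flow
  -- formula.
  have hid : EqOn (ι.toFun (T a g)) (F ∘ ψ) (ball (v a) δ) := by
    have hd1 : DifferentiableOn ℂ (ι.toFun (T a g)) (ball (v a) δ) :=
      (ι.holomorphic _).mono fun y hy => (hδsub hy).1
    have hd2 : DifferentiableOn ℂ (F ∘ ψ) (ball (v a) δ) :=
      hFd.comp ((ι.holomorphic _).mono fun y hy => (hδsub hy).1) fun y hy => Or.inr (hδsub hy).2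
    refine (hd1.analyticOnNhd isOpen_ball).eqOn_of_preconnected_of_frequently_eq
      (hd2.analyticOnNhd isOpen_ball) (convex_ball _ _).isPreconnected (mem_ball_self hδ)
      (hva.frequently (Eventually.frequently ?_))
    filter_upwards [self_mem_nhdsWithin, nhdsWithin_le_nhds (lt_mem_nhds ha)] with s hsa hs
    have hsa : s < a := hsa
    rw [Function.comp_apply, hψv s hs.le (hsa.trans hab),
      hF (hvΩ _ (by linarith) (by linarith)), ← hflow _ s hs.le (hsa.trans hab),
      ← hflow _ _ (by linarith) (by linarith), ← hT.add_apply hs.le ha.le]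
  rw [hid (hK (hpK x hx)), Function.comp_apply, hp x hx]

/-- All solutions are restrictions of the one curve `v`, so they glue. A finite supremum of
existence times would itself be an existence time, and one that can be exceeded. -/
theorem isSolution_eval_orbit (hT : IsC0Semigroup T) (ι : Embedding Ω X) (hΩ : IsOpen Ω)
    (hTG : GeneratedBy ι T G) {e : X} (he : EqOn (ι.toFun e) (fun z => z) Ω)
    (hG : DifferentiableOn ℂ G Ω) (hmax : ι.MaximalDomain) (hdense : ι.DensityCondition) {z : ℂ}
    (hz : z ∈ Ω) : IsSolution Ω G z ⊤ (fun t => ι.toFun (T t e) z) := by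
  set v : ℝ → ℂ := fun t => ι.toFun (T t e) z with hv
  have hv0 : v 0 = z := by simp only [hv, hT.zero_apply]; exact he hz
  have glue : ∀ b : EReal, (∀ t : ℝ, 0 ≤ t → (t : EReal) < b → ∃ c : ℝ, t < c ∧
      IsSolution Ω G z c v) → IsSolution Ω G z b v := fun b h =>
    ⟨hv0, fun t ht htb => let ⟨_, htc, hc⟩ := h t ht htb; hc.mem t ht (EReal.coe_lt_coe_iff.2 htc),
      fun t ht htb => let ⟨_, htc, hc⟩ := h t ht htb; hc.deriv t ht (EReal.coe_lt_coe_iff.2 htc)⟩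
  obtain ⟨δ, hδ, hex⟩ := exists_isSolution_nhds hΩ hG hz
  obtain ⟨u, hu⟩ := hex.self_of_nhds
  have huv : ∀ t, 0 ≤ t → t < δ → v t = u t := fun t ht htδ =>
    (hT.eq_eval_of_isSolution ι hΩ hTG he hu ht (EReal.coe_lt_coe_iff.2 htδ)).symm
  have hδsol : IsSolution Ω G z δ v := by
    refine ⟨hv0, fun t ht htδ => ?_, fun t ht htδ => ?_⟩
    · rw [huv t ht (EReal.coe_lt_coe_iff.1 htδ)]
      exact hu.mem t ht htδ
    · have htδ' := EReal.coe_lt_coe_iff.1 htδ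
      rw [huv t ht htδ']
      refine (hu.deriv t ht htδ).congr_of_eventuallyEq ?_ (huv t ht htδ')
      filter_upwards [self_mem_nhdsWithin, nhdsWithin_le_nhds (gt_mem_nhds htδ')] with s hs hsδ
      exact huv s hs hsδ
  set S : Set ℝ := {b | IsSolution Ω G z b v} with hS
  by_cases hbdd : BddAbove S
  · exfalso
    have hpos : 0 < sSup S := hδ.trans_le (le_csSup hbdd hδsol)
    have hsup : IsSolution Ω G z (sSup S : ℝ) v := glue _ fun t _ htb =>
      let ⟨c, hc, htc⟩ := exists_lt_of_lt_csSup ⟨δ, hδsol⟩ (EReal.coe_lt_coe_iff.1 htb)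
      ⟨c, htc, hc⟩
    obtain ⟨c, hc, hcS⟩ := hT.exists_isSolution_extension ι hΩ hTG he hG hz hpos hsup
      (hT.eval_orbit_mem ι hΩ hTG hmax hdense hz hpos hsup)
    exact absurd (le_csSup hbdd hcS) (not_le.2 hc)
  · refine glue _ fun t _ _ => ?_
    obtain ⟨c, hc, htc⟩ := not_bddAbove_iff.1 hbdd t
    exact ⟨c, htc, hc⟩

/-- Whichever solution the definition of `semiflow` selects, the semigroup forces it to be the orbit
of `e`; no separate ODE uniqueness theorem is needed. -/
theorem semiflow_eq (hT : IsC0Semigroup T) (ι : Embedding Ω X) (hΩ : IsOpen Ω)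
    (hTG : GeneratedBy ι T G) {e : X} (he : EqOn (ι.toFun e) (fun z => z) Ω) {z : ℂ}
    (hsol : IsSolution Ω G z ⊤ (fun t => ι.toFun (T t e) z)) {t : ℝ} (ht : 0 ≤ t) :
    semiflow Ω G t z = ι.toFun (T t e) z := by
  have h : ∃ u : ℝ → ℂ, ∃ b : EReal, (t : EReal) < b ∧ IsSolution Ω G z b u :=
    ⟨_, ⊤, EReal.coe_lt_top t, hsol⟩
  rw [semiflow, dif_pos h]
  obtain ⟨b, htb, hu⟩ := h.choose_spec
  exact hT.eq_eval_of_isSolution ι hΩ hTG he hu ht htb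

theorem hasGeneratorValue_of_eqOn (hT : IsC0Semigroup T) (ι : Embedding Ω X) (hΩ : IsOpen Ω)
    (hTG : GeneratedBy ι T G) (hsol : ∀ z ∈ Ω, ∃ u, IsSolution Ω G z ⊤ u) {f g : X}
    (hg : EqOn (ι.toFun g) (fun z => G z * deriv (ι.toFun f) z) Ω) : HasGeneratorValue T f g := by
  -- At each `z`, both `(T s f) z = f (u s)` and the integral have right derivative `g (u s) = (T s
  -- g) z`; injectivity of the embedding turns this into an identity in `X`.
  have key : ∀ t, 0 ≤ t → T t f = f + orbitIntegral T g t := by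
    intro t ht
    refine ι.injective _ _ fun z hz => ?_
    obtain ⟨u, hu⟩ := hsol z hz
    have hmem : ∀ s, 0 ≤ s → u s ∈ Ω := fun s hs => hu.mem s hs (EReal.coe_lt_top s)
    have hflow : ∀ h : X, ∀ s, 0 ≤ s → ι.toFun (T s h) z = ι.toFun h (u s) := fun h s hs =>
      hT.eval_eq_of_isSolution ι hΩ hTG hu hs (EReal.coe_lt_top s) h
    have hder : ∀ s, 0 ≤ s → HasDerivWithinAt (fun s => ι.toFun (T s f) z - ι.toFun
        (orbitIntegral T g s) z) 0 (Ici s) s := by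
      intro s hs
      have h1 : HasDerivWithinAt (fun s => ι.toFun f (u s)) (ι.toFun (T s g) z) (Ici s) s := by
        rw [hflow g s hs, hg (hmem s hs)]
        refine HasDerivWithinAt.congr_deriv ?_ (mul_comm (deriv (ι.toFun f) (u s)) (G (u s)))
        exact (ι.hasDerivAt_toFun hΩ f (hmem s hs)).comp_hasDerivWithinAt s
          ((hu.deriv s hs (EReal.coe_lt_top s)).mono (Ici_subset_Ici.2 hs))
      have h2 := ((ι.evalCLM hz).restrictScalars ℝ).hasFDerivAt.comp_hasDerivWithinAt s
        (hT.hasDerivAt_orbitIntegral g hs).hasDerivWithinAt (s := Ici s)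
      have h3 := (h1.congr (fun r hr => hflow f r (hs.trans hr)) (hflow f s hs)).sub h2
      exact h3.congr_deriv (by simp)
    have hcont : ContinuousOn (fun s => ι.toFun (T s f) z - ι.toFun (orbitIntegral T g s) z)
        (Icc 0 t) := by
      refine ((hT.continuousOn_eval_orbit ι f hz).mono Icc_subset_Ici_self).sub
        ((ι.evalCLM hz).continuous.comp_continuousOn fun s hs => ?_)
      exact (hT.hasDerivAt_orbitIntegral g hs.1).continuousAt.continuousWithinAt
    have := constant_of_has_deriv_right_zero hcont (fun s hs => hder s hs.1) t ⟨ht, le_rfl⟩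
    simp only [hT.zero_apply, orbitIntegral_zero, map_zero, Pi.zero_apply, sub_zero] at this
    rw [map_add, Pi.add_apply, ← this, sub_add_cancel]
  rw [hT.hasGeneratorValue_iff_hasDerivWithinAt]
  have h2 := (hT.hasDerivAt_orbitIntegral g le_rfl).const_add f
  rw [hT.zero_apply] at h2
  exact h2.hasDerivWithinAt.congr (fun t ht => key t ht) (key 0 le_rfl)

end IsC0Semigroup

end HolSemi
end

theorem theorem4p1
    {Ω : Set ℂ} (hΩ_open : IsOpen Ω) (hΩ_conn : IsConnected Ω) (hΩ_bdd : Bornology.IsBounded Ω)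
    (hΩ_reg : HolSemi.WeakBoundaryRegular Ω)
    {X : Type*} [NormedAddCommGroup X] [NormedSpace ℂ X] [CompleteSpace X]
    (ι : HolSemi.Embedding Ω X)
    (h_max : ι.MaximalDomain)
    (h_id : ι.Contains (fun z => z))
    (h_dense : ι.DensityCondition)
    {G : ℂ → ℂ} (hG : DifferentiableOn ℂ G Ω)
    {T : ℝ → X →L[ℂ] X} (hT : HolSemi.IsC0Semigroup T)
    (hA : ∀ f : (HolSemi.generator T).domain, ∀ z ∈ Ω,
      ι.toFun (HolSemi.generator T f) z = G z * deriv (ι.toFun (f : X)) z) :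
    -- the semiflow is global, that is, defined and a solution in `Ω` for all times
    HolSemi.IsGlobalSemiflow Ω G ∧
    (∀ z ∈ Ω, HolSemi.IsSolution Ω G z ⊤ (fun t => HolSemi.semiflow Ω G t z)) ∧
    -- the semigroup consists of composition operators
    (∀ (t : ℝ), 0 ≤ t → ∀ f : X, ∀ z ∈ Ω,
      ι.toFun (T t f) z = ι.toFun f (HolSemi.semiflow Ω G t z)) ∧
    -- the domain of the generator is maximal
    (∀ f : X, f ∈ (HolSemi.generator T).domain ↔
      ι.Contains (fun z => G z * deriv (ι.toFun f) z)) := by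
  have hTG : HolSemi.GeneratedBy ι T G := fun f g hfg z hz => by
    have h := (HolSemi.hasGeneratorValue_generator T ⟨f, g, hfg⟩).unique hfg
    rw [← h]
    exact hA ⟨f, g, hfg⟩ z hz
  obtain ⟨e, he⟩ := h_id
  have hsol := fun z (hz : z ∈ Ω) =>
    hT.isSolution_eval_orbit ι hΩ_open hTG he hG h_max h_dense hz
  have hflow := fun z (hz : z ∈ Ω) (t : ℝ) (ht : 0 ≤ t) =>
    hT.semiflow_eq ι hΩ_open hTG he (hsol z hz) ht
  refine ⟨fun z hz => top_le_iff.1 (le_sSup ⟨_, hsol z hz⟩), fun z hz => ?_, fun t ht f z hz => ?_,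
    fun f => ⟨?_, ?_⟩⟩
  · refine ⟨(hflow z hz 0 le_rfl).trans (hsol z hz).initial, fun t ht htb => ?_, fun t ht htb => ?_⟩
    · rw [hflow z hz t ht]
      exact (hsol z hz).mem t ht htb
    · rw [hflow z hz t ht]
      exact ((hsol z hz).deriv t ht htb).congr (fun s hs => hflow z hz s hs) (hflow z hz t ht)
  · rw [hflow z hz t ht]
    exact hT.eval_eq_of_isSolution ι hΩ_open hTG (hsol z hz) ht (EReal.coe_lt_top t) f
  · rintro ⟨g, hg⟩
    exact ⟨g, hTG f g hg⟩
  · rintro ⟨g, hg⟩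
    exact ⟨g, hT.hasGeneratorValue_of_eqOn ι hΩ_open hTG (fun z hz => ⟨_, hsol z hz⟩) hg⟩
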